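/- Let $\Bbbk$ be a field and let $\mathrm{Var}$ be a variety of (not necessarily associative) $\Bbbk$-algebras with one binary product, defined by polylinear identities. Let $X$ be a set, $\dot X=\{\dot x\mid x\in X\}$ a disjoint copy of $X$, and $F=\mathrm{Var}\langle X\cup\dot X\rangle$ the free algebra of $\mathrm{Var}$ generated by $X\cup\dot X$. Let $\varphi:F\to F$ be the homomorphism with $\varphi(x)=\varphi(\dot x)=x$ for $x\in X$. On the space $F$ define the operations $$f\vdash g=\varphi(f)g,\qquad f\dashv g=f\varphi(g),\qquad f\perp g=fg .$$ For $P\subseteq F$ let $(P)$ denote the (two-sided) ideal of the algebra $F$ generated by $P$. (Tri-algebras.) Let $V\subseteq F$ be the subalgebra generated by $\dot X$ with respect to the operations $\vdash,\dashv,\perp$. For $S\subseteq V$ let $(S)^{(3)}$ be the ideal of the tri-algebra $(V,\vdash,\dashv,\perp)$ generated by $S$. Then $$(S)^{(3)}=(S\cup\varphi(S))\cap V .$$ (Di-algebras.) Let $V'\subseteq F$ be the subalgebra generated by $\dot X$ with respect to the operations $\vdash,\dashv$ (equivalently, the space of polynomials linear in $\dot X$). For $S\subseteq V'$ let $(S)^{(2)}$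 be the ideal of the di-algebra $(V',\vdash,\dashv)$ generated by $S$. Then $$(S)^{(2)}=(S\cup\varphi(S))\cap V' .$$ -/

import Mathlib

universe u v w

noncomputable section

namespace Replication

/-! ### Ideals and subalgebras with respect to bilinear operations -/

section Ops

variable (k : Type v) {A : Type w} [Field k] [AddCommGroup A] [Module k A]

/-- The subalgebra generated by `s` in the linear space `A` equipped with the binary operations
`ops`: the smallest linear subspace that contains `s` and is closed under all the operations. -/
def opAdjoin (ops : Set (A → A → A)) (s : Set A) : Submodule k A :=
  sInf {W | s ⊆ W ∧ ∀ o ∈ ops, ∀ a ∈ W, ∀ b ∈ W, o a b ∈ W}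

/-- `J` is an ideal of the algebra `V`, where `V` is a subalgebra of the linear space `A` equipped
with the binary operations `ops`. -/
def IsOpIdeal (ops : Set (A → A → A)) (V J : Submodule k A) : Prop :=
  J ≤ V ∧ ∀ o ∈ ops, ∀ a ∈ V, ∀ j ∈ J, o a j ∈ J ∧ o j a ∈ J

/-- The ideal of the algebra `V` generated by `s ⊆ V`: the smallest ideal of `V` containing `s`. -/
def opIdeal (ops : Set (A → A → A)) (V : Submodule k A) (s : Set A) : Submodule k A :=
  sInf {J | IsOpIdeal k ops V J ∧ s ⊆ J}

variable {k}

theorem subset_opAdjoin (ops : Set (A → A → A)) (s : Set A) :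
    s ⊆ (opAdjoin k ops s : Set A) := by
  intro x hx
  simp only [opAdjoin, SetLike.mem_coe, Submodule.mem_sInf, Set.mem_ofPred_eq]
  exact fun W hW => hW.1 hx

theorem op_mem_opAdjoin {ops : Set (A → A → A)} {s : Set A} {o : A → A → A} (ho : o ∈ ops)
    {a b : A} (ha : a ∈ opAdjoin k ops s) (hb : b ∈ opAdjoin k ops s) :
    o a b ∈ opAdjoin k ops s := by
  simp only [opAdjoin, Submodule.mem_sInf, Set.mem_ofPred_eq] at ha hb ⊢
  exact fun W hW => hW.2 o ho a (ha W hW) b (hb W hW)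

theorem opAdjoin_le {ops : Set (A → A → A)} {s : Set A} {W : Submodule k A} (hs : s ⊆ W)
    (hW : ∀ o ∈ ops, ∀ a ∈ W, ∀ b ∈ W, o a b ∈ W) : opAdjoin k ops s ≤ W :=
  sInf_le ⟨hs, hW⟩

theorem subset_opIdeal (ops : Set (A → A → A)) (V : Submodule k A) (s : Set A) :
    s ⊆ (opIdeal k ops V s : Set A) := by
  intro x hx
  simp only [opIdeal, SetLike.mem_coe, Submodule.mem_sInf, Set.mem_ofPred_eq]
  exact fun J hJ => hJ.2 hx

/-- If `V` is closed under the operations and contains `s`, then `opIdeal k ops V s` is indeed an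
ideal of `V`. -/
theorem isOpIdeal_opIdeal {ops : Set (A → A → A)} {V : Submodule k A} {s : Set A}
    (hV : ∀ o ∈ ops, ∀ a ∈ V, ∀ b ∈ V, o a b ∈ V) (hs : s ⊆ V) :
    IsOpIdeal k ops V (opIdeal k ops V s) := by
  refine ⟨sInf_le ⟨⟨le_rfl, fun o ho a ha j hj => ⟨hV o ho a ha j hj, hV o ho j hj a ha⟩⟩, hs⟩, ?_⟩
  intro o ho a ha j hj
  simp only [opIdeal, Submodule.mem_sInf, Set.mem_ofPred_eq] at hj ⊢
  exact ⟨fun J hJ => (hJ.1.2 o ho a ha j (hj J hJ)).1, fun J hJ => (hJ.1.2 o ho a ha j (hj J hJ)).2⟩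

end Ops

section Ideal

variable (k : Type v) {A : Type w} [Field k] [NonUnitalNonAssocRing A] [Module k A]

/-- The (two-sided) ideal `(P)` of a not necessarily associative `k`-algebra `A` generated by its
subset `P`. -/
def idealGen (P : Set A) : Submodule k A :=
  opIdeal k {fun a b : A => a * b} ⊤ P

variable {k}

theorem subset_idealGen (P : Set A) : P ⊆ (idealGen k P : Set A) :=
  subset_opIdeal _ _ _

theorem isOpIdeal_idealGen (P : Set A) :
    IsOpIdeal k {fun a b : A => a * b} ⊤ (idealGen k P) :=
  isOpIdeal_opIdeal (fun _ _ _ _ _ _ => Submodule.mem_top) fun _ _ => Submodule.mem_top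

theorem mul_mem_idealGen_left {P : Set A} (a : A) {b : A} (hb : b ∈ idealGen k P) :
    a * b ∈ idealGen k P :=
  ((isOpIdeal_idealGen P).2 (fun a b : A => a * b) rfl a Submodule.mem_top b hb).1

theorem mul_mem_idealGen_right {P : Set A} (a : A) {b : A} (hb : b ∈ idealGen k P) :
    b * a ∈ idealGen k P :=
  ((isOpIdeal_idealGen P).2 (fun a b : A => a * b) rfl a Submodule.mem_top b hb).2

theorem idealGen_le {P : Set A} {J : Submodule k A} (hP : P ⊆ J)
    (hJ : ∀ a : A, ∀ j ∈ J, a * j ∈ J ∧ j * a ∈ J) : idealGen k P ≤ J := by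
  refine sInf_le ⟨⟨le_top, ?_⟩, hP⟩
  rintro o rfl a - j hj
  exact hJ a j hj

end Ideal

/-! ### Varieties defined by polylinear identities, and their free algebras -/

section Variety

/-- The multiset of letters of a nonassociative monomial. -/
def letters {Y : Type u} : FreeMagma Y → Multiset Y
  | .of y => {y}
  | .mul a b => letters a + letters b

/-- A nonassociative polynomial in the variables `x₀, x₁, …` is polylinear if for some finite set
`t` of variables every variable from `t` occurs exactly once in each of its monomials, and no other
variable occurs. -/
def IsPolylinear {k : Type v} [Field k] (Φ : FreeNonUnitalNonAssocAlgebra k ℕ) : Prop :=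
  ∃ t : Finset ℕ, ∀ m ∈ Φ.coeff.support, letters m = t.val

variable {k : Type v} [Field k]

/-- The algebra `A` belongs to the variety defined by the identities `Φ = 0`, `Φ ∈ Id`. -/
def Satisfies (Id : Set (FreeNonUnitalNonAssocAlgebra k ℕ)) (A : Type w) [NonUnitalNonAssocRing A]
    [Module k A] [IsScalarTower k A A] [SMulCommClass k A A] : Prop :=
  ∀ Φ ∈ Id, ∀ σ : ℕ → A, FreeNonUnitalNonAssocAlgebra.lift k σ Φ = 0

/-- The ideal of the free nonassociative algebra on `Y` generated by all values of the
polynomials from `Id`. -/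
def verbalIdeal (Id : Set (FreeNonUnitalNonAssocAlgebra k ℕ)) (Y : Type u) :
    Submodule k (FreeNonUnitalNonAssocAlgebra k Y) :=
  idealGen k {f | ∃ Φ ∈ Id, ∃ σ : ℕ → FreeNonUnitalNonAssocAlgebra k Y,
    f = FreeNonUnitalNonAssocAlgebra.lift k σ Φ}

/-- The free algebra `Var⟨Y⟩` of the variety `Var` defined by the identities `Φ = 0`, `Φ ∈ Id`. -/
def VarFree (Id : Set (FreeNonUnitalNonAssocAlgebra k ℕ)) (Y : Type u) : Type (max u v) :=
  FreeNonUnitalNonAssocAlgebra k Y ⧸ verbalIdeal Id Y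

namespace VarFree

variable (Id : Set (FreeNonUnitalNonAssocAlgebra k ℕ)) (Y : Type u)

instance : AddCommGroup (VarFree Id Y) :=
  inferInstanceAs (AddCommGroup (FreeNonUnitalNonAssocAlgebra k Y ⧸ verbalIdeal Id Y))

instance : Module k (VarFree Id Y) :=
  inferInstanceAs (Module k (FreeNonUnitalNonAssocAlgebra k Y ⧸ verbalIdeal Id Y))

/-- The quotient map onto the free algebra of the variety. -/
def mkLinear : FreeNonUnitalNonAssocAlgebra k Y →ₗ[k] VarFree Id Y :=
  (verbalIdeal Id Y).mkQ

theorem mkLinear_surjective : Function.Surjective (mkLinear Id Y) :=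
  Submodule.mkQ_surjective _

variable {Id Y} in
theorem mkLinear_eq_iff {f g : FreeNonUnitalNonAssocAlgebra k Y} :
    mkLinear Id Y f = mkLinear Id Y g ↔ f - g ∈ verbalIdeal Id Y :=
  Submodule.Quotient.eq _

/-- The product of two classes is the class of the product. -/
instance : Mul (VarFree Id Y) where
  mul := Quotient.map₂ (· * ·) (by
    intro a a' ha b b' hb
    have ha' := (Submodule.quotientRel_def _).1 ha
    have hb' := (Submodule.quotientRel_def _).1 hb
    refine (Submodule.quotientRel_def _).2 ?_
    have h : a * b - a' * b' = (a - a') * b + a' * (b - b') := by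
      rw [sub_mul, mul_sub]; abel
    change a * b - a' * b' ∈ _
    rw [h]
    exact add_mem (mul_mem_idealGen_right _ ha') (mul_mem_idealGen_left _ hb'))

variable {Id Y} in
theorem mkLinear_mul (f g : FreeNonUnitalNonAssocAlgebra k Y) :
    mkLinear Id Y (f * g) = mkLinear Id Y f * mkLinear Id Y g := rfl

instance : NonUnitalNonAssocRing (VarFree Id Y) :=
  { (inferInstance : AddCommGroup (VarFree Id Y)), (inferInstance : Mul (VarFree Id Y)) with
    left_distrib := by
      intro a b c
      obtain ⟨a, rfl⟩ := mkLinear_surjective Id Y a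
      obtain ⟨b, rfl⟩ := mkLinear_surjective Id Y b
      obtain ⟨c, rfl⟩ := mkLinear_surjective Id Y c
      rw [← map_add, ← mkLinear_mul, ← mkLinear_mul, ← mkLinear_mul, ← map_add, mul_add]
    right_distrib := by
      intro a b c
      obtain ⟨a, rfl⟩ := mkLinear_surjective Id Y a
      obtain ⟨b, rfl⟩ := mkLinear_surjective Id Y b
      obtain ⟨c, rfl⟩ := mkLinear_surjective Id Y c
      rw [← map_add, ← mkLinear_mul, ← mkLinear_mul, ← mkLinear_mul, ← map_add, add_mul]
    zero_mul := by
      intro a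
      obtain ⟨a, rfl⟩ := mkLinear_surjective Id Y a
      rw [← map_zero (mkLinear Id Y), ← mkLinear_mul, zero_mul]
    mul_zero := by
      intro a
      obtain ⟨a, rfl⟩ := mkLinear_surjective Id Y a
      rw [← map_zero (mkLinear Id Y), ← mkLinear_mul, mul_zero] }

instance : IsScalarTower k (VarFree Id Y) (VarFree Id Y) where
  smul_assoc c a b := by
    obtain ⟨a, rfl⟩ := mkLinear_surjective Id Y a
    obtain ⟨b, rfl⟩ := mkLinear_surjective Id Y b
    simp only [smul_eq_mul]
    rw [← map_smul, ← mkLinear_mul, ← mkLinear_mul, ← map_smul, smul_mul_assoc]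

instance : SMulCommClass k (VarFree Id Y) (VarFree Id Y) where
  smul_comm c a b := by
    obtain ⟨a, rfl⟩ := mkLinear_surjective Id Y a
    obtain ⟨b, rfl⟩ := mkLinear_surjective Id Y b
    simp only [smul_eq_mul]
    rw [← map_smul, ← mkLinear_mul, ← mkLinear_mul, ← map_smul, mul_smul_comm]

/-- The quotient map as a homomorphism of algebras. -/
def mk : FreeNonUnitalNonAssocAlgebra k Y →ₙₐ[k] VarFree Id Y :=
  { mkLinear Id Y with
    map_zero' := map_zero (mkLinear Id Y)
    map_mul' := mkLinear_mul }

theorem mk_surjective : Function.Surjective (mk Id Y) := mkLinear_surjective Id Y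

variable {Y}

/-- The free generators. -/
def of (y : Y) : VarFree Id Y := mk Id Y (FreeNonUnitalNonAssocAlgebra.of k y)

/-- The class in `Var⟨Y⟩` of a nonassociative monomial. -/
def monomial (m : FreeMagma Y) : VarFree Id Y := mk Id Y (MonoidAlgebra.single m 1)

variable {Id}

section Lift

variable {A : Type w} [NonUnitalNonAssocRing A] [Module k A] [IsScalarTower k A A]
  [SMulCommClass k A A]

theorem verbalIdeal_le_ker (hA : Satisfies Id A) (h : Y → A) :
    verbalIdeal Id Y ≤
      LinearMap.ker (FreeNonUnitalNonAssocAlgebra.lift k h : _ →ₗ[k] A) := by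
  refine idealGen_le ?_ ?_
  · rintro f ⟨Φ, hΦ, σ, rfl⟩
    have hc : (FreeNonUnitalNonAssocAlgebra.lift k h).comp (FreeNonUnitalNonAssocAlgebra.lift k σ)
        = FreeNonUnitalNonAssocAlgebra.lift k
            (fun i => FreeNonUnitalNonAssocAlgebra.lift k h (σ i)) := by
      apply FreeNonUnitalNonAssocAlgebra.hom_ext
      intro i
      simp
    have := hA Φ hΦ (fun i => FreeNonUnitalNonAssocAlgebra.lift k h (σ i))
    rw [← hc] at this
    exact this
  · intro a j hj
    have hj' : FreeNonUnitalNonAssocAlgebra.lift k h j = 0 := hj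
    constructor
    · change FreeNonUnitalNonAssocAlgebra.lift k h (a * j) = 0
      rw [map_mul, hj', mul_zero]
    · change FreeNonUnitalNonAssocAlgebra.lift k h (j * a) = 0
      rw [map_mul, hj', zero_mul]

/-- The homomorphism from `Var⟨Y⟩` to an algebra `A` of the variety that extends `h : Y → A`. -/
def lift (hA : Satisfies Id A) (h : Y → A) : VarFree Id Y →ₙₐ[k] A :=
  { (verbalIdeal Id Y).liftQ _ (verbalIdeal_le_ker hA h) with
    map_zero' := map_zero ((verbalIdeal Id Y).liftQ _ (verbalIdeal_le_ker hA h))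
    map_mul' := by
      intro a b
      obtain ⟨a, rfl⟩ := mk_surjective Id Y a
      obtain ⟨b, rfl⟩ := mk_surjective Id Y b
      exact map_mul (FreeNonUnitalNonAssocAlgebra.lift k h) a b }

theorem lift_mk (hA : Satisfies Id A) (h : Y → A) (f : FreeNonUnitalNonAssocAlgebra k Y) :
    lift hA h (mk Id Y f) = FreeNonUnitalNonAssocAlgebra.lift k h f := rfl

theorem lift_of (hA : Satisfies Id A) (h : Y → A) (y : Y) : lift hA h (of Id y) = h y := by
  rw [of, lift_mk, FreeNonUnitalNonAssocAlgebra.lift_of_apply]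

theorem hom_ext {F G : VarFree Id Y →ₙₐ[k] A} (h : ∀ y, F (of Id y) = G (of Id y)) : F = G := by
  have hc : F.comp (mk Id Y) = G.comp (mk Id Y) :=
    FreeNonUnitalNonAssocAlgebra.hom_ext k h
  ext a
  obtain ⟨a, rfl⟩ := mk_surjective Id Y a
  exact DFunLike.congr_fun hc a

end Lift

/-- `Var⟨Y⟩` belongs to the variety. -/
theorem satisfies (Id : Set (FreeNonUnitalNonAssocAlgebra k ℕ)) (Y : Type u) :
    Satisfies Id (VarFree Id Y) := by
  intro Φ hΦ σ
  choose τ hτ using fun i => mk_surjective Id Y (σ i)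
  have hc : (mk Id Y).comp (FreeNonUnitalNonAssocAlgebra.lift k τ)
      = FreeNonUnitalNonAssocAlgebra.lift k σ := by
    apply FreeNonUnitalNonAssocAlgebra.hom_ext
    intro i
    simp [hτ]
  rw [← hc]
  exact (Submodule.Quotient.mk_eq_zero (verbalIdeal Id Y)).2
    (subset_idealGen _ ⟨Φ, hΦ, τ, rfl⟩)

end VarFree

/-! ### The algebra `F = Var⟨X ∪ Ẋ⟩`, the endomorphism `φ` and the replicated operations -/

variable (Id : Set (FreeNonUnitalNonAssocAlgebra k ℕ)) (X : Type u)

/-- `F = Var⟨X ∪ Ẋ⟩`. The set `X ∪ Ẋ` is `X ⊕ X`, where `Sum.inl x` is the letter `x` and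
`Sum.inr x` is its copy `ẋ`. -/
abbrev F : Type (max u v) := VarFree Id (X ⊕ X)

/-- The endomorphism `φ` of `F` with `φ(x) = φ(ẋ) = x` for all `x ∈ X`. -/
def phi : F Id X →ₙₐ[k] F Id X :=
  VarFree.lift (VarFree.satisfies Id (X ⊕ X))
    (Sum.elim (fun x => VarFree.of Id (Sum.inl x)) (fun x => VarFree.of Id (Sum.inl x)))

/-- `f ⊢ g = φ(f) g`. -/
def vdash (f g : F Id X) : F Id X := phi Id X f * g

/-- `f ⊣ g = f φ(g)`. -/
def dashv (f g : F Id X) : F Id X := f * phi Id X g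

/-- `f ⊥ g = f g`. -/
def perp (f g : F Id X) : F Id X := f * g

/-- The operations of the di-algebra on the space `F`. -/
def diOps : Set (F Id X → F Id X → F Id X) := {vdash Id X, dashv Id X}

/-- The operations of the tri-algebra on the space `F`. -/
def triOps : Set (F Id X → F Id X → F Id X) := {vdash Id X, dashv Id X, perp Id X}

/-- The image of `Ẋ` in `F`. -/
def dotX : Set (F Id X) := Set.range fun x : X => VarFree.of Id (Sum.inr x)

/-- The tri-subalgebra of `F` generated by `Ẋ`. -/
def triV : Submodule k (F Id X) := opAdjoin k (triOps Id X) (dotX Id X)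

/-- The di-subalgebra of `F` generated by `Ẋ`. -/
def diV : Submodule k (F Id X) := opAdjoin k (diOps Id X) (dotX Id X)

/-- The ideal generated by `S` in the tri-algebra `triV`. -/
def triIdeal (S : Set (F Id X)) : Submodule k (F Id X) := opIdeal k (triOps Id X) (triV Id X) S

/-- The ideal generated by `S` in the di-algebra `diV`. -/
def diIdeal (S : Set (F Id X)) : Submodule k (F Id X) := opIdeal k (diOps Id X) (diV Id X) S

/-! `diV` is the space of polynomials linear in `Ẋ`. -/

/-- The degree in `Ẋ` of a monomial in the letters `X ∪ Ẋ`. -/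
def dotDeg {X : Type u} (m : FreeMagma (X ⊕ X)) : ℕ := (letters m).countP (fun y => y.isRight)

/-- The subspace of `F` spanned by the monomials of degree `n` in `Ẋ`. -/
def dotHom (n : ℕ) : Submodule k (F Id X) :=
  Submodule.span k (VarFree.monomial Id '' {m | dotDeg m = n})

variable {Id X}

theorem dotDeg_mul (a b : FreeMagma (X ⊕ X)) : dotDeg (a * b) = dotDeg a + dotDeg b :=
  Multiset.countP_add _ _ _

theorem monomial_mul (a b : FreeMagma (X ⊕ X)) :
    VarFree.monomial Id (a * b) = VarFree.monomial Id a * VarFree.monomial Id b := by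
  rw [VarFree.monomial, VarFree.monomial, VarFree.monomial, ← map_mul,
    MonoidAlgebra.single_mul_single, one_mul]

theorem mul_mem_dotHom {m n : ℕ} {a b : F Id X} (ha : a ∈ dotHom Id X m)
    (hb : b ∈ dotHom Id X n) : a * b ∈ dotHom Id X (m + n) := by
  induction ha using Submodule.span_induction with
  | zero => rw [zero_mul]; exact zero_mem _
  | add x y _ _ hx hy => rw [add_mul]; exact add_mem hx hy
  | smul c x _ hx => rw [smul_mul_assoc]; exact Submodule.smul_mem _ c hx
  | mem x hx =>
    obtain ⟨p, hp, rfl⟩ := hx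
    induction hb using Submodule.span_induction with
    | zero => rw [mul_zero]; exact zero_mem _
    | add x y _ _ hx hy => rw [mul_add]; exact add_mem hx hy
    | smul c x _ hx => rw [mul_smul_comm]; exact Submodule.smul_mem _ c hx
    | mem y hy =>
      obtain ⟨q, hq, rfl⟩ := hy
      refine Submodule.subset_span ⟨p * q, ?_, monomial_mul p q⟩
      change dotDeg (p * q) = m + n
      rw [dotDeg_mul]
      exact congrArg₂ (· + ·) hp hq

theorem phi_of (y : X ⊕ X) :
    phi Id X (VarFree.of Id y) = VarFree.of Id (Sum.inl (Sum.elim id id y)) := by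
  rw [phi, VarFree.lift_of]
  cases y <;> rfl

theorem phi_monomial_mem (m : FreeMagma (X ⊕ X)) :
    phi Id X (VarFree.monomial Id m) ∈ dotHom Id X 0 := by
  induction m using FreeMagma.recOnMul with
  | ih1 y =>
    refine Submodule.subset_span ⟨FreeMagma.of (Sum.inl (Sum.elim id id y)), rfl, ?_⟩
    exact (phi_of y).symm
  | ih2 a b ha hb =>
    rw [monomial_mul, map_mul]
    have h := mul_mem_dotHom ha hb
    rwa [add_zero] at h

theorem phi_mem_dotHom {n : ℕ} {a : F Id X} (ha : a ∈ dotHom Id X n) :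
    phi Id X a ∈ dotHom Id X 0 := by
  induction ha using Submodule.span_induction with
  | zero => rw [map_zero]; exact zero_mem _
  | add x y _ _ hx hy => rw [map_add]; exact add_mem hx hy
  | smul c x _ hx => rw [map_smul]; exact Submodule.smul_mem _ c hx
  | mem x hx =>
    obtain ⟨p, -, rfl⟩ := hx
    exact phi_monomial_mem p

theorem exists_phi_eq (m : FreeMagma (X ⊕ X)) (hm : dotDeg m = 0) :
    ∃ v ∈ diV Id X, phi Id X v = VarFree.monomial Id m := by
  induction m using FreeMagma.recOnMul with
  | ih1 y =>
    cases y with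
    | inl x => exact ⟨_, subset_opAdjoin _ _ ⟨x, rfl⟩, phi_of _⟩
    | inr x => exact absurd hm one_ne_zero
  | ih2 a b ha hb =>
    rw [dotDeg_mul] at hm
    obtain ⟨v, hv, hva⟩ := ha (by omega)
    obtain ⟨w, hw, hwb⟩ := hb (by omega)
    refine ⟨vdash Id X v w, op_mem_opAdjoin (Or.inl rfl) hv hw, ?_⟩
    rw [monomial_mul, ← hva, ← hwb, vdash, map_mul]
    congr 1
    rw [hva]
    have key : ∀ m : FreeMagma (X ⊕ X), dotDeg m = 0 →
        phi Id X (VarFree.monomial Id m) = VarFree.monomial Id m := by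
      intro m hm
      induction m using FreeMagma.recOnMul with
      | ih1 y =>
        cases y with
        | inl x => exact phi_of _
        | inr x => exact absurd hm one_ne_zero
      | ih2 a b ha hb =>
        rw [dotDeg_mul] at hm
        rw [monomial_mul, map_mul, ha (by omega), hb (by omega)]
    exact key a (by omega)

theorem monomial_mem_diV (m : FreeMagma (X ⊕ X)) (hm : dotDeg m = 1) :
    VarFree.monomial Id m ∈ diV Id X := by
  induction m using FreeMagma.recOnMul with
  | ih1 y =>
    cases y with
    | inl x => exact absurd hm zero_ne_one
    | inr x => exact subset_opAdjoin _ _ ⟨x, rfl⟩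
  | ih2 a b ha hb =>
    rw [dotDeg_mul] at hm
    rw [monomial_mul]
    rcases Nat.eq_zero_or_pos (dotDeg a) with h | h
    · obtain ⟨v, hv, hva⟩ := exists_phi_eq (Id := Id) a h
      rw [← hva]
      exact op_mem_opAdjoin (o := vdash Id X) (Or.inl rfl) hv (hb (by omega))
    · obtain ⟨v, hv, hvb⟩ := exists_phi_eq (Id := Id) b (by omega)
      rw [← hvb]
      exact op_mem_opAdjoin (o := dashv Id X) (Or.inr rfl) (ha (by omega)) hv

/-- The di-subalgebra of `F` generated by `Ẋ` is the space of polynomials linear in `Ẋ`. -/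
theorem diV_eq_dotHom (Id : Set (FreeNonUnitalNonAssocAlgebra k ℕ)) (X : Type u) :
    diV Id X = dotHom Id X 1 := by
  refine le_antisymm (opAdjoin_le ?_ ?_) (Submodule.span_le.2 ?_)
  · rintro _ ⟨x, rfl⟩
    exact Submodule.subset_span ⟨FreeMagma.of (Sum.inr x), rfl, rfl⟩
  · rintro o (rfl | rfl) a ha b hb
    · have h := mul_mem_dotHom (phi_mem_dotHom ha) hb
      rwa [zero_add] at h
    · have h := mul_mem_dotHom ha (phi_mem_dotHom hb)
      rwa [add_zero] at h
  · rintro _ ⟨m, hm, rfl⟩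
    exact monomial_mem_diV m hm

end Variety

end Replication

end

/-!
Let `V` be the tri- or di-subalgebra and `J` the ideal of `V` generated by `S`. The intersection
`(S ∪ φ(S)) ∩ V` is an ideal of `V` because `φ` is idempotent, so that `φ` maps `(S ∪ φ(S))` into
itself; hence it contains `J`.

For the converse, choose an ideal `W` of `F` such that the products of `V` with `J` taken in `F`
lie in `J + W`. Then `V + φ(V) + W` is a subalgebra of `F` containing the generators, so it is `F`,
and the same computation with `J` in place of one factor `V` shows that `J + φ(J) + W` is an ideal
of `F` (`mul_mem_hull`). It contains `S ∪ φ(S)`, and meets `V` in `J` as soon as the sum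
`V + (φ(V) + W)` is direct (`opIdeal_eq`).

* For the tri-algebra take `W = 0`. The endomorphism `x ↦ x`, `ẋ ↦ 0` of `F` kills `V` and fixes
  `φ(V)`, so the sum is direct. Polylinearity plays no role.
* For the di-algebra take for `W` the kernel of the homomorphism `δ : F → F[ε]/(ε²)`, `x ↦ x`,
  `ẋ ↦ εẋ`. It is `v ↦ εv` on `V` and the identity on `φ(V)`, so that `V · V ⊆ W` and the sum is
  direct. This is where the identities have to be polylinear: they are then inherited by
  `F[ε]/(ε²)` (`DualExt.satisfies`), which is what makes `δ` exist.
-/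

noncomputable section

namespace Replication

/-! ### Dual numbers over a nonassociative algebra -/

/-- The algebra `A[ε]/(ε²)` over a not necessarily associative algebra `A`; the pair `⟨a, b⟩` stands
for `a + εb`. (Mathlib's `TrivSqZeroExt` has a ring structure only over an associative `A`.) -/
@[ext]
structure DualExt (A : Type w) : Type w where
  fst : A
  snd : A

namespace DualExt

/-- The underlying pair. -/
def equivProd (A : Type w) : DualExt A ≃ A × A where
  toFun p := (p.1, p.2)
  invFun p := ⟨p.1, p.2⟩

variable {k : Type v} [Field k] {A : Type w} [NonUnitalNonAssocRing A] [Module k A]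

instance : AddCommGroup (DualExt A) := (equivProd A).addCommGroup

instance : Module k (DualExt A) := (equivProd A).module k

instance : Mul (DualExt A) where
  mul p q := ⟨p.1 * q.1, p.2 * q.1 + p.1 * q.2⟩

@[simp] theorem fst_mul (p q : DualExt A) : (p * q).1 = p.1 * q.1 := rfl

@[simp] theorem snd_mul (p q : DualExt A) : (p * q).2 = p.2 * q.1 + p.1 * q.2 := rfl

@[simp] theorem fst_add (p q : DualExt A) : (p + q).1 = p.1 + q.1 := rfl

@[simp] theorem snd_add (p q : DualExt A) : (p + q).2 = p.2 + q.2 := rfl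

@[simp] theorem fst_zero : (0 : DualExt A).1 = 0 := rfl

@[simp] theorem snd_zero : (0 : DualExt A).2 = 0 := rfl

@[simp] theorem fst_smul (c : k) (p : DualExt A) : (c • p).1 = c • p.1 := rfl

@[simp] theorem snd_smul (c : k) (p : DualExt A) : (c • p).2 = c • p.2 := rfl

instance : NonUnitalNonAssocRing (DualExt A) :=
  { (inferInstance : AddCommGroup (DualExt A)), (inferInstance : Mul (DualExt A)) with
    left_distrib := fun a b c => by
      ext <;> simp only [fst_mul, snd_mul, fst_add, snd_add, mul_add]
      abel
    right_distrib := fun a b c => by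
      ext <;> simp only [fst_mul, snd_mul, fst_add, snd_add, add_mul]
      abel
    zero_mul := fun a => by ext <;> simp
    mul_zero := fun a => by ext <;> simp }

instance [IsScalarTower k A A] : IsScalarTower k (DualExt A) (DualExt A) where
  smul_assoc c a b := by ext <;> simp [smul_mul_assoc]

instance [SMulCommClass k A A] : SMulCommClass k (DualExt A) (DualExt A) where
  smul_comm c a b := by ext <;> simp [mul_smul_comm]

variable (k A) in
/-- The homomorphism `a + εb ↦ a`. -/
def fstHom : DualExt A →ₙₐ[k] A where
  toFun p := p.1
  map_smul' _ _ := rfl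
  map_zero' := rfl
  map_add' _ _ := rfl
  map_mul' _ _ := rfl

variable (k A) in
/-- The linear map `a + εb ↦ b`. -/
def sndLinear : DualExt A →ₗ[k] A where
  toFun p := p.2
  map_smul' _ _ := rfl
  map_add' _ _ := rfl

variable (k A) in
/-- The inclusion of `A` into `A[ε]/(ε²)`. -/
def inlHom : A →ₙₐ[k] DualExt A where
  toFun a := ⟨a, 0⟩
  map_smul' c _ := DualExt.ext rfl (smul_zero c).symm
  map_zero' := rfl
  map_add' _ _ := DualExt.ext rfl (add_zero 0).symm
  map_mul' a b := by
    ext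
    · rfl
    · change 0 = 0 * b + a * 0
      rw [zero_mul, mul_zero, add_zero]

variable (k A) in
/-- The linear map `a ↦ εa`. -/
def inrLinear : A →ₗ[k] DualExt A where
  toFun a := ⟨0, a⟩
  map_smul' c _ := DualExt.ext (smul_zero c).symm rfl
  map_add' _ _ := DualExt.ext (add_zero 0).symm rfl

@[simp] theorem fst_inlHom (a : A) : (inlHom k A a).1 = a := rfl

@[simp] theorem snd_inlHom (a : A) : (inlHom k A a).2 = 0 := rfl

@[simp] theorem fst_inrLinear (a : A) : (inrLinear k A a).1 = 0 := rfl

@[simp] theorem snd_inrLinear (a : A) : (inrLinear k A a).2 = a := rfl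

theorem fst_lift_magma (σ : ℕ → DualExt A) (m : FreeMagma ℕ) :
    (FreeMagma.lift σ m).1 = FreeMagma.lift (fun i => (σ i).1) m := by
  induction m using FreeMagma.recOnMul with
  | ih1 i => rfl
  | ih2 a b ha hb => rw [map_mul, map_mul, fst_mul, ha, hb]

end DualExt

theorem lift_magma_congr {A : Type w} [Mul A] {σ τ : ℕ → A} (m : FreeMagma ℕ)
    (h : ∀ i ∈ letters m, σ i = τ i) : FreeMagma.lift σ m = FreeMagma.lift τ m := by
  induction m using FreeMagma.recOnMul with
  | ih1 i => exact h i (Multiset.mem_singleton_self i)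
  | ih2 a b ha hb =>
    rw [map_mul, map_mul, ha fun i hi => h i (Multiset.mem_add.2 (Or.inl hi)),
      hb fun i hi => h i (Multiset.mem_add.2 (Or.inr hi))]

namespace DualExt

variable {k : Type v} [Field k] {A : Type w} [NonUnitalNonAssocRing A] [Module k A]

/-- The Leibniz rule: the `ε`-part of the value of a multilinear monomial is the sum of the values
obtained by replacing one argument with its `ε`-part and the others with their constant parts. -/
theorem snd_lift_magma (σ : ℕ → DualExt A) (m : FreeMagma ℕ) (hm : (letters m).Nodup) :
    (FreeMagma.lift σ m).2 = ((letters m).map fun i =>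
      FreeMagma.lift (Function.update (fun j => (σ j).1) i (σ i).2) m).sum := by
  induction m using FreeMagma.recOnMul with
  | ih1 i =>
    change (σ i).2 = (({i} : Multiset ℕ).map fun i' =>
      Function.update (fun j => (σ j).1) i' (σ i').2 i).sum
    rw [Multiset.map_singleton, Multiset.sum_singleton, Function.update_self]
  | ih2 a b ha hb =>
    have hab : letters (a * b) = letters a + letters b := rfl
    rw [hab, Multiset.nodup_add] at hm
    obtain ⟨hna, hnb, hdisj⟩ := hm
    rw [map_mul, snd_mul, ha hna, hb hnb, fst_lift_magma, fst_lift_magma, hab, Multiset.map_add,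
      Multiset.sum_add, ← Multiset.sum_map_mul_right, ← Multiset.sum_map_mul_left]
    congr 2
    · refine Multiset.map_congr rfl fun i hi => ?_
      rw [map_mul, lift_magma_congr (τ := Function.update (fun j => (σ j).1) i (σ i).2) b
        fun j hj => (Function.update_of_ne ?_ _ _).symm]
      rintro rfl
      exact Multiset.disjoint_left.1 hdisj hi hj
    · refine Multiset.map_congr rfl fun i hi => ?_
      rw [map_mul, lift_magma_congr (τ := Function.update (fun j => (σ j).1) i (σ i).2) a
        fun j hj => (Function.update_of_ne ?_ _ _).symm]
      rintro rfl
      exact Multiset.disjoint_left.1 hdisj hj hi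

variable [IsScalarTower k A A] [SMulCommClass k A A]

/-- Polylinear identities of `A` hold in `A[ε]/(ε²)`. -/
theorem satisfies {Id : Set (FreeNonUnitalNonAssocAlgebra k ℕ)}
    (hId : ∀ Φ ∈ Id, IsPolylinear Φ) (hA : Satisfies Id A) : Satisfies Id (DualExt A) := by
  intro Φ hΦ σ
  have hsum : ∀ {B : Type w} [NonUnitalNonAssocRing B] [Module k B] [IsScalarTower k B B]
      [SMulCommClass k B B] (τ : ℕ → B), FreeNonUnitalNonAssocAlgebra.lift k τ Φ =
        ∑ m ∈ Φ.coeff.support, Φ.coeff m • FreeMagma.lift τ m := fun _ => rfl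
  ext
  · have hc : (fstHom k A).comp (FreeNonUnitalNonAssocAlgebra.lift k σ) =
        FreeNonUnitalNonAssocAlgebra.lift k fun i => (σ i).1 := by
      apply FreeNonUnitalNonAssocAlgebra.hom_ext
      intro i
      rw [NonUnitalAlgHom.comp_apply, FreeNonUnitalNonAssocAlgebra.lift_of_apply,
        FreeNonUnitalNonAssocAlgebra.lift_of_apply]
      rfl
    exact (DFunLike.congr_fun hc Φ).trans (hA Φ hΦ _)
  · obtain ⟨t, ht⟩ := hId Φ hΦ
    change sndLinear k A (FreeNonUnitalNonAssocAlgebra.lift k σ Φ) = 0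
    calc
      _ = ∑ m ∈ Φ.coeff.support, Φ.coeff m • (FreeMagma.lift σ m).2 := by
        rw [hsum, map_sum]
        exact Finset.sum_congr rfl fun m _ => map_smul _ _ _
      _ = ∑ m ∈ Φ.coeff.support, ∑ i ∈ t, Φ.coeff m •
            FreeMagma.lift (Function.update (fun j => (σ j).1) i (σ i).2) m := by
        refine Finset.sum_congr rfl fun m hm => ?_
        rw [snd_lift_magma σ m (by rw [ht m hm]; exact t.nodup), ht m hm, ← Finset.smul_sum]
        rfl
      _ = ∑ i ∈ t, FreeNonUnitalNonAssocAlgebra.lift k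
            (Function.update (fun j => (σ j).1) i (σ i).2) Φ := by
        rw [Finset.sum_comm]
        exact Finset.sum_congr rfl fun i _ => (hsum _).symm
      _ = 0 := Finset.sum_eq_zero fun i _ => hA Φ hΦ _

end DualExt

variable {k : Type v} [Field k] {Id : Set (FreeNonUnitalNonAssocAlgebra k ℕ)} {X : Type u}

/-! ### Generators of `F` and the idempotent `φ` -/

theorem VarFree.eq_top_of_mul_mem {Y : Type u} {T : Submodule k (VarFree Id Y)}
    (hof : ∀ y, VarFree.of Id y ∈ T) (hmul : ∀ a ∈ T, ∀ b ∈ T, a * b ∈ T) : T = ⊤ := by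
  have hmon : ∀ m : FreeMagma Y, VarFree.mk Id Y (MonoidAlgebra.single m 1) ∈ T := by
    intro m
    induction m using FreeMagma.recOnMul with
    | ih1 y => exact hof y
    | ih2 a b ha hb =>
      have h : (MonoidAlgebra.single (a * b) 1 : FreeNonUnitalNonAssocAlgebra k Y) =
          MonoidAlgebra.single a 1 * MonoidAlgebra.single b 1 := by
        rw [MonoidAlgebra.single_mul_single, one_mul]
      rw [h, map_mul]
      exact hmul _ ha _ hb
  refine eq_top_iff.2 fun a _ => ?_
  obtain ⟨f, rfl⟩ := VarFree.mk_surjective Id Y a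
  induction f using MonoidAlgebra.induction_linear with
  | zero => rw [map_zero]; exact zero_mem _
  | add f g hf hg =>
    rw [map_add]
    exact add_mem (hf trivial) (hg trivial)
  | single m c =>
    have h : (MonoidAlgebra.single m c : FreeNonUnitalNonAssocAlgebra k Y) =
        c • MonoidAlgebra.single m 1 := by
      rw [MonoidAlgebra.smul_single, smul_eq_mul, mul_one]
    rw [h, map_smul]
    exact T.smul_mem c (hmon m)

theorem phi_phi (a : F Id X) : phi Id X (phi Id X a) = phi Id X a := by
  have h : (phi Id X).comp (phi Id X) = phi Id X := by
    apply VarFree.hom_ext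
    intro y
    rw [NonUnitalAlgHom.comp_apply, phi_of, phi_of]
    rfl
  exact DFunLike.congr_fun h a

theorem phi_mem_idealGen {S : Set (F Id X)} {a : F Id X}
    (ha : a ∈ idealGen k (S ∪ phi Id X '' S)) : phi Id X a ∈ idealGen k (S ∪ phi Id X '' S) := by
  suffices h : idealGen k (S ∪ phi Id X '' S) ≤
      (idealGen k (S ∪ phi Id X '' S)).comap (phi Id X : F Id X →ₗ[k] F Id X) from h ha
  refine idealGen_le ?_ fun a j hj => ?_
  · rintro _ (hs | ⟨s, hs, rfl⟩)
    · exact subset_idealGen _ (Or.inr ⟨_, hs, rfl⟩)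
    · change phi Id X (phi Id X s) ∈ idealGen k (S ∪ phi Id X '' S)
      rw [phi_phi]
      exact subset_idealGen _ (Or.inr ⟨_, hs, rfl⟩)
  · have hj' : phi Id X j ∈ idealGen k (S ∪ phi Id X '' S) := hj
    constructor
    · change phi Id X (a * j) ∈ idealGen k (S ∪ phi Id X '' S)
      rw [map_mul]
      exact mul_mem_idealGen_left _ hj'
    · change phi Id X (j * a) ∈ idealGen k (S ∪ phi Id X '' S)
      rw [map_mul]
      exact mul_mem_idealGen_right _ hj'

/-! ### From ideals of a replicated algebra to ideals of `F` -/

/-- The subspace `J + φ(J) + W` of `F`. -/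
def hull (J W : Submodule k (F Id X)) : Submodule k (F Id X) :=
  J ⊔ J.map (phi Id X : F Id X →ₗ[k] F Id X) ⊔ W

section Hull

variable {J V W : Submodule k (F Id X)}

theorem left_mem_hull {a : F Id X} (ha : a ∈ J) : a ∈ hull J W :=
  Submodule.mem_sup_left (Submodule.mem_sup_left ha)

theorem phi_mem_hull {a : F Id X} (ha : a ∈ J) : phi Id X a ∈ hull J W :=
  Submodule.mem_sup_left (Submodule.mem_sup_right ⟨a, ha, rfl⟩)

theorem right_mem_hull {a : F Id X} (ha : a ∈ W) : a ∈ hull J W :=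
  Submodule.mem_sup_right ha

theorem sup_le_hull : J ⊔ W ≤ hull J W :=
  sup_le_sup_right le_sup_left W

theorem mem_hull {a : F Id X} (ha : a ∈ hull J W) :
    ∃ i ∈ J, ∃ j ∈ J, ∃ w ∈ W, a = i + phi Id X j + w := by
  obtain ⟨b, hb, w, hw, rfl⟩ := Submodule.mem_sup.1 ha
  obtain ⟨i, hi, _, ⟨j, hj, rfl⟩, rfl⟩ := Submodule.mem_sup.1 hb
  exact ⟨i, hi, j, hj, w, hw, rfl⟩

/-- If `J` is an ideal of the replicated algebra `V`, then `J + φ(J) + W` absorbs multiplication by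
`V + φ(V) + W`, provided that this holds for the ordinary products of `V` with `J`. -/
theorem mul_mem_hull {ops : Set (F Id X → F Id X → F Id X)} (hops : diOps Id X ⊆ ops)
    (hJ : IsOpIdeal k ops V J) (hVJ : ∀ a ∈ V, ∀ j ∈ J, a * j ∈ J ⊔ W ∧ j * a ∈ J ⊔ W)
    (hW : ∀ a, ∀ w ∈ W, a * w ∈ W ∧ w * a ∈ W) {a b : F Id X} (ha : a ∈ hull V W)
    (hb : b ∈ hull J W) : a * b ∈ hull J W ∧ b * a ∈ hull J W := by
  have hvd : ∀ v ∈ V, ∀ j ∈ J, phi Id X v * j ∈ J ∧ phi Id X j * v ∈ J :=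
    hJ.2 (vdash Id X) (hops (Or.inl rfl))
  have hdv : ∀ v ∈ V, ∀ j ∈ J, v * phi Id X j ∈ J ∧ j * phi Id X v ∈ J :=
    hJ.2 (dashv Id X) (hops (Or.inr rfl))
  obtain ⟨v, hv, v', hv', w, hw, rfl⟩ := mem_hull ha
  obtain ⟨i, hi, j, hj, u, hu, rfl⟩ := mem_hull hb
  have hφ₁ : phi Id X v' * phi Id X j = phi Id X (phi Id X v' * j) := by rw [map_mul, phi_phi]
  have hφ₂ : phi Id X j * phi Id X v' = phi Id X (phi Id X j * v') := by rw [map_mul, phi_phi]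
  constructor
  · rw [add_mul _ w, mul_add _ _ u, add_mul, mul_add, mul_add, hφ₁]
    exact add_mem (add_mem (add_mem
      (add_mem (sup_le_hull (hVJ v hv i hi).1) (left_mem_hull (hdv v hv j hj).1))
      (add_mem (left_mem_hull (hvd v' hv' i hi).1) (phi_mem_hull (hvd v' hv' j hj).1)))
      (right_mem_hull (hW _ u hu).1)) (right_mem_hull (hW _ w hw).2)
  · rw [mul_add _ _ w, add_mul _ u, mul_add, add_mul, add_mul, hφ₂]
    exact add_mem (add_mem (add_mem
      (add_mem (sup_le_hull (hVJ v hv i hi).2) (left_mem_hull (hvd v hv j hj).2))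
      (add_mem (left_mem_hull (hdv v' hv' i hi).2) (phi_mem_hull (hvd v' hv' j hj).2)))
      (right_mem_hull (hW _ u hu).2)) (right_mem_hull (hW _ w hw).1)

end Hull

/-- The common part of the tri- and di-algebra cases: it remains to find an ideal `W` of `F` that
absorbs the excess of ordinary products over replicated ones (`hprod`), and is so small that the sum
`V + (φ(V) + W)` is direct (`hsep`). -/
theorem opIdeal_eq {ops : Set (F Id X → F Id X → F Id X)} (hdi : diOps Id X ⊆ ops)
    (htri : ops ⊆ triOps Id X) {V W : Submodule k (F Id X)}
    (hVdef : V = opAdjoin k ops (dotX Id X))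
    (hW : ∀ a, ∀ w ∈ W, a * w ∈ W ∧ w * a ∈ W)
    (hprod : ∀ J, IsOpIdeal k ops V J → ∀ a ∈ V, ∀ j ∈ J, a * j ∈ J ⊔ W ∧ j * a ∈ J ⊔ W)
    (hsep : ∀ v ∈ V, ∀ v' ∈ V, ∀ w ∈ W, v = phi Id X v' + w → v = 0)
    {S : Set (F Id X)} (hS : S ⊆ V) :
    opIdeal k ops V S = idealGen k (S ∪ phi Id X '' S) ⊓ V := by
  have hV : ∀ o ∈ ops, ∀ a ∈ V, ∀ b ∈ V, o a b ∈ V := by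
    subst hVdef
    exact fun o ho a ha b hb => op_mem_opAdjoin ho ha hb
  have hVV : IsOpIdeal k ops V V :=
    ⟨le_rfl, fun o ho a ha b hb => ⟨hV o ho a ha b hb, hV o ho b hb a ha⟩⟩
  have hdot : ∀ x : X, VarFree.of Id (Sum.inr x) ∈ V := by
    subst hVdef
    exact fun x => subset_opAdjoin _ _ ⟨x, rfl⟩
  have htop : hull V W = ⊤ := by
    refine VarFree.eq_top_of_mul_mem ?_ fun a ha b hb =>
      (mul_mem_hull hdi hVV (hprod V hVV) hW ha hb).1
    rintro (x | x)
    · have h := phi_mem_hull (W := W) (hdot x)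
      rwa [phi_of] at h
    · exact left_mem_hull (hdot x)
  have hJ : IsOpIdeal k ops V (opIdeal k ops V S) := isOpIdeal_opIdeal hV hS
  have hSJ : S ⊆ (opIdeal k ops V S : Set (F Id X)) := subset_opIdeal _ _ _
  refine le_antisymm ?_ ?_
  · refine sInf_le ⟨⟨inf_le_right, ?_⟩, fun s hs => ⟨subset_idealGen _ (Or.inl hs), hS hs⟩⟩
    rintro o ho a ha j ⟨hj, hjV⟩
    refine ⟨⟨?_, hV o ho a ha j hjV⟩, ⟨?_, hV o ho j hjV a ha⟩⟩
    · rcases htri ho with rfl | rfl | rfl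
      · exact mul_mem_idealGen_left _ hj
      · exact mul_mem_idealGen_left _ (phi_mem_idealGen hj)
      · exact mul_mem_idealGen_left _ hj
    · rcases htri ho with rfl | rfl | rfl
      · exact mul_mem_idealGen_right _ (phi_mem_idealGen hj)
      · exact mul_mem_idealGen_right _ hj
      · exact mul_mem_idealGen_right _ hj
  · rintro a ⟨ha, haV⟩
    have hle : idealGen k (S ∪ phi Id X '' S) ≤ hull (opIdeal k ops V S) W := by
      refine idealGen_le ?_ fun b j hj =>
        mul_mem_hull hdi hJ (hprod _ hJ) hW (htop ▸ Submodule.mem_top) hj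
      rintro _ (hs | ⟨s, hs, rfl⟩)
      · exact left_mem_hull (hSJ hs)
      · exact phi_mem_hull (hSJ hs)
    obtain ⟨i, hi, j, hj, w, hw, rfl⟩ := mem_hull (hle ha)
    have h := hsep _ (sub_mem haV (hJ.1 hi)) j (hJ.1 hj) w hw (by abel)
    rw [sub_eq_zero.1 h]
    exact hi

/-! ### The constant part and the linear part of an element of `F` -/

variable (Id X) in
/-- The endomorphism of `F` with `x ↦ x` and `ẋ ↦ 0` for all `x ∈ X`. -/
def constPart : F Id X →ₙₐ[k] F Id X :=
  VarFree.lift (VarFree.satisfies Id (X ⊕ X)) (Sum.elim (fun x => VarFree.of Id (Sum.inl x)) 0)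

theorem constPart_phi (a : F Id X) : constPart Id X (phi Id X a) = phi Id X a := by
  have h : (constPart Id X).comp (phi Id X) = phi Id X := by
    apply VarFree.hom_ext
    intro y
    rw [NonUnitalAlgHom.comp_apply, phi_of, constPart, VarFree.lift_of]
    rfl
  exact DFunLike.congr_fun h a

theorem constPart_of_mem_triV {v : F Id X} (hv : v ∈ triV Id X) : constPart Id X v = 0 := by
  suffices h : triV Id X ≤ LinearMap.ker (constPart Id X : F Id X →ₗ[k] F Id X) from h hv
  refine opAdjoin_le ?_ ?_
  · rintro _ ⟨x, rfl⟩
    exact VarFree.lift_of (VarFree.satisfies Id (X ⊕ X)) _ _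
  · intro o ho a ha b hb
    have ha' : constPart Id X a = 0 := ha
    have hb' : constPart Id X b = 0 := hb
    change constPart Id X (o a b) = 0
    rcases ho with rfl | rfl | rfl
    · rw [vdash, map_mul, hb', mul_zero]
    · rw [dashv, map_mul, ha', zero_mul]
    · rw [perp, map_mul, hb', mul_zero]

/-- The homomorphism `δ : F → F[ε]/(ε²)` with `x ↦ x` and `ẋ ↦ εẋ` for all `x ∈ X`. -/
def jet (hId : ∀ Φ ∈ Id, IsPolylinear Φ) (X : Type u) : F Id X →ₙₐ[k] DualExt (F Id X) :=
  VarFree.lift (DualExt.satisfies hId (VarFree.satisfies Id (X ⊕ X)))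
    (Sum.elim (fun x => DualExt.inlHom k _ (VarFree.of Id (Sum.inl x)))
      (fun x => DualExt.inrLinear k _ (VarFree.of Id (Sum.inr x))))

variable (hId : ∀ Φ ∈ Id, IsPolylinear Φ)

theorem jet_phi (a : F Id X) : jet hId X (phi Id X a) = DualExt.inlHom k _ (phi Id X a) := by
  have h : (jet hId X).comp (phi Id X) = (DualExt.inlHom k _).comp (phi Id X) := by
    apply VarFree.hom_ext
    intro y
    rw [NonUnitalAlgHom.comp_apply, NonUnitalAlgHom.comp_apply, phi_of, jet, VarFree.lift_of]
    rfl
  exact DFunLike.congr_fun h a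

theorem jet_of_mem_diV {v : F Id X} (hv : v ∈ diV Id X) :
    jet hId X v = DualExt.inrLinear k _ v := by
  suffices h : diV Id X ≤ LinearMap.eqLocus (jet hId X : F Id X →ₗ[k] DualExt (F Id X))
      (DualExt.inrLinear k (F Id X)) from h hv
  refine opAdjoin_le ?_ ?_
  · rintro _ ⟨x, rfl⟩
    exact VarFree.lift_of (DualExt.satisfies hId (VarFree.satisfies Id (X ⊕ X))) _ _
  · intro o ho a ha b hb
    have ha' : jet hId X a = DualExt.inrLinear k _ a := ha
    have hb' : jet hId X b = DualExt.inrLinear k _ b := hb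
    change jet hId X (o a b) = DualExt.inrLinear k _ (o a b)
    rcases ho with rfl | rfl
    · rw [vdash, map_mul, jet_phi, hb']
      ext <;> simp
    · rw [dashv, map_mul, jet_phi, ha']
      ext <;> simp

theorem jet_mul_of_mem_diV {v w : F Id X} (hv : v ∈ diV Id X) (hw : w ∈ diV Id X) :
    jet hId X (v * w) = 0 := by
  rw [map_mul, jet_of_mem_diV hId hv, jet_of_mem_diV hId hw]
  ext <;> simp

end Replication

end

theorem theorem4p1 {k : Type v} [Field k]
    (Id : Set (FreeNonUnitalNonAssocAlgebra k ℕ))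
    (hId : ∀ Φ ∈ Id, Replication.IsPolylinear Φ) (X : Type u) :
    (∀ S : Set (Replication.F Id X), S ⊆ Replication.triV Id X →
      Replication.triIdeal Id X S =
        Replication.idealGen k (S ∪ Replication.phi Id X '' S) ⊓ Replication.triV Id X) ∧
    (∀ S : Set (Replication.F Id X), S ⊆ Replication.diV Id X →
      Replication.diIdeal Id X S =
        Replication.idealGen k (S ∪ Replication.phi Id X '' S) ⊓ Replication.diV Id X) := by
  open Replication in
  constructor
  · intro S hS
    refine opIdeal_eq (W := ⊥) ?_ subset_rfl rfl ?_ ?_ ?_ hS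
    · rintro o (rfl | rfl)
      · exact Or.inl rfl
      · exact Or.inr (Or.inl rfl)
    · rintro a w hw
      rw [(Submodule.mem_bot k).1 hw, mul_zero, zero_mul]
      exact ⟨zero_mem _, zero_mem _⟩
    · intro J hJ a ha j hj
      have h := hJ.2 (perp Id X) (Or.inr (Or.inr rfl)) a ha j hj
      exact ⟨Submodule.mem_sup_left h.1, Submodule.mem_sup_left h.2⟩
    · intro v hv v' hv' w hw h
      rw [(Submodule.mem_bot k).1 hw, add_zero] at h
      have h' := constPart_of_mem_triV hv
      rwa [h, constPart_phi, ← h] at h'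
  · intro S hS
    refine opIdeal_eq (W := LinearMap.ker (jet hId X : F Id X →ₗ[k] DualExt (F Id X)))
      subset_rfl ?_ rfl ?_ ?_ ?_ hS
    · rintro o (rfl | rfl)
      · exact Or.inl rfl
      · exact Or.inr (Or.inl rfl)
    · intro a w hw
      have hw' : jet hId X w = 0 := hw
      constructor
      · change jet hId X (a * w) = 0
        rw [map_mul, hw', mul_zero]
      · change jet hId X (w * a) = 0
        rw [map_mul, hw', zero_mul]
    · intro J hJ a ha j hj
      exact ⟨Submodule.mem_sup_right (jet_mul_of_mem_diV hId ha (hJ.1 hj)),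
        Submodule.mem_sup_right (jet_mul_of_mem_diV hId (hJ.1 hj) ha)⟩
    · intro v hv v' hv' w hw h
      have hw' : jet hId X w = 0 := hw
      -- Compare the `ε`-parts of both sides of `δ(v) = δ(φ(v')) + δ(w)`.
      have h' := congrArg (fun a => (jet hId X a).2) h
      simpa [map_add, jet_of_mem_diV hId hv, jet_phi, hw'] using h'
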